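/- Fix a finite-dimensional quantum system with Hilbert space $\mathbb{C}^{n}$, $n\ge 1$. A channel is a completely positive trace-preserving linear map on the complex $n\times n$ matrices. Let $s(\rho)=-\mathrm{Tr}(\rho\ln\rho)$ be the von Neumann entropy. The Holevo capacity of a channel $\mathcal{N}$ is $$\chi(\mathcal{N})=\sup_{\{p_i,\rho_i\}}\Big\{ s\Big(\sum_i p_i\,\mathcal{N}(\rho_i)\Big)-\sum_i p_i\, s(\mathcal{N}(\rho_i))\Big\},$$ where the supremum (in the extended reals) is over all finite ensembles of density matrices $\rho_i$ with probabilities $p_i$. Let $\Lambda(X)=\mathrm{Tr}(X)\,\mathbb{I}/n$ be the free channel. Given a set $\mathfrak{O}$ of channels (the free operations of the static theory), the set of allowed operations $\mathfrak{O}^{\mathrm{dy}}$ consists of the super-channels $$\Pi(\mathcal{N})=\sum_{\kappa}p_\kappa\,\mathcal{E}_\kappa\circ\mathcal{N}\circ\mathcal{P}_\kappa ,\qquad \mathcal{E}_\kappa,\mathcal{P}_\kappa\in\mathfrak{O},$$ where $\kappa$ ranges over a finite set and $(p_\kappa)$ is a probability distribution. Consider the following two theories. (a) The qubit theory: $n=2$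 and $\mathfrak{O}$ is the set of mixed unitary channels $X\mapsto\sum_i p_i U_iXU_i^\dagger$ (finite sums, $p_i\ge 0$, $\sum_i p_i=1$, $U_i$ unitary). (b) The $n$-dimensional Weyl-covariant theory, for any $n\ge 1$: $\mathfrak{O}$ is the set of channels $\mathcal{N}$ with $\mathcal{N}(W_{ab}XW_{ab}^\dagger)=W_{ab}\,\mathcal{N}(X)\,W_{ab}^\dagger$ for all $X$ and all $a,b\in\{0,\dots,n-1\}$, where $W_{ab}=\sum_{c=0}^{n-1}e^{2\pi i bc/n}\,|c+a \bmod n\rangle\langle c|$. Lemma (the Holevo capacity is a monotone). In each of the theories (a) and (b), $\chi(\Lambda)=0$, and for all $\mathcal{M},\mathcal{N}\in\mathfrak{O}$, if there is an allowed operation $\Pi\in\mathfrak{O}^{\mathrm{dy}}$ with $\mathcal{M}=\Pi(\mathcal{N})$, then $\chi(\mathcal{M})\le\chi(\mathcal{N})$. -/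

import Mathlib

noncomputable section

/-- Operators on the `n`-dimensional system, as complex `n × n` matrices. -/
abbrev QOp (n : ℕ) : Type := Matrix (Fin n) (Fin n) ℂ

/-- Linear maps on operators of the `n`-dimensional system. -/
abbrev QMap (n : ℕ) : Type := QOp n →ₗ[ℂ] QOp n

open scoped ComplexOrder in
/-- Density matrices: positive semidefinite of unit trace. -/
structure IsDensity {n : ℕ} (ρ : QOp n) : Prop where
  posSemidef : ρ.PosSemidef
  trace_eq_one : ρ.trace = 1

open scoped ComplexOrder MatrixOrder Matrix.Norms.L2Operator CStarAlgebra in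
/-- Quantum channels: completely positive trace-preserving linear maps. Matrices carry the
operator norm and the Loewner order, so that complete positivity is the usual one. -/
structure IsQuantumChannel {n : ℕ} (N : QMap n) : Prop where
  completelyPositive : ∃ f : QOp n →CP QOp n, f.toLinearMap = N
  tracePreserving : ∀ X : QOp n, (N X).trace = X.trace

/-- The von Neumann entropy `s(ρ) = -∑ λ ln λ` over the eigenvalues of `ρ`, with multiplicity
(and the irrelevant value `0` when `ρ` is not Hermitian). -/
def vonNeumannEntropy {n : ℕ} (ρ : QOp n) : ℝ :=
  open scoped Classical in
  if h : ρ.IsHermitian then ∑ i, Real.negMulLog (h.eigenvalues i) else 0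

/-- Finite ensembles `{p i, ρ i}` of states of the `n`-dimensional system. -/
structure QEnsemble (n : ℕ) where
  size : ℕ
  prob : Fin size → ℝ
  state : Fin size → QOp n
  prob_nonneg : ∀ i, 0 ≤ prob i
  prob_sum : ∑ i, prob i = 1
  state_isDensity : ∀ i, IsDensity (state i)

/-- The Holevo quantity of the image of an ensemble:
`s(∑ p i N(ρ i)) - ∑ p i s(N(ρ i))`. -/
def holevoQuantity {n : ℕ} (N : QMap n) (e : QEnsemble n) : ℝ :=
  vonNeumannEntropy (∑ i, (e.prob i : ℂ) • N (e.state i)) -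
    ∑ i, e.prob i * vonNeumannEntropy (N (e.state i))

/-- The Holevo capacity: the supremum of the Holevo quantity over all ensembles, taken in the
extended reals so that it is a genuine supremum. -/
def holevoCapacity {n : ℕ} (N : QMap n) : EReal :=
  ⨆ e : QEnsemble n, (holevoQuantity N e : EReal)

/-- The free channel `Λ(X) = Tr(X) 𝟙 / n`. -/
def freeChannel (n : ℕ) : QMap n where
  toFun X := X.trace • ((n : ℂ)⁻¹ • (1 : QOp n))
  map_add' X Y := by rw [Matrix.trace_add, add_smul]
  map_smul' c X := by rw [Matrix.trace_smul, smul_assoc, RingHom.id_apply]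

/-- Mixed unitary channels `X ↦ ∑ p i U i X (U i)†`, with `p` a probability vector and every
`U i` unitary. -/
def mixedUnitaryChannels (n : ℕ) : Set (QMap n) :=
  {N | ∃ (k : ℕ) (p : Fin k → ℝ) (U : Fin k → QOp n),
    (∀ i, 0 ≤ p i) ∧ ∑ i, p i = 1 ∧ (∀ i, U i ∈ Matrix.unitaryGroup (Fin n) ℂ) ∧
      ∀ X, N X = ∑ i, (p i : ℂ) • (U i * X * (U i).conjTranspose)}

/-- The discrete Weyl operators `W a b = ∑ c, Ω ^ (b c) |c + a mod n⟩⟨c|`, `Ω = exp (2πi / n)`. -/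
def weylOperator {n : ℕ} [NeZero n] (a b : Fin n) : QOp n :=
  Matrix.of fun r c =>
    if r = c + a then Complex.exp (2 * Real.pi * Complex.I / n) ^ (b.val * c.val) else 0

/-- Weyl-covariant channels: channels with `N(W X W†) = W N(X) W†` for every discrete Weyl
operator `W`. -/
def weylCovariantChannels (n : ℕ) [NeZero n] : Set (QMap n) :=
  {N | IsQuantumChannel N ∧ ∀ (a b : Fin n) (X : QOp n),
    N (weylOperator a b * X * (weylOperator a b).conjTranspose) =
      weylOperator a b * N X * (weylOperator a b).conjTranspose}

/-- The allowed operations (super-channels) `Π(N) = ∑ p κ • E κ ∘ N ∘ P κ` of the dynamical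
theory built on a set `F` of free operations of the static theory: pre- and post-processing in
`F`, with shared randomness `p`. -/
def allowedSuperchannels {n : ℕ} (F : Set (QMap n)) : Set (QMap n →ₗ[ℂ] QMap n) :=
  {Pi | ∃ (k : ℕ) (p : Fin k → ℝ) (E P : Fin k → QMap n),
    (∀ i, 0 ≤ p i) ∧ ∑ i, p i = 1 ∧ (∀ i, E i ∈ F) ∧ (∀ i, P i ∈ F) ∧
      ∀ N, Pi N = ∑ i, (p i : ℂ) • (E i ∘ₗ N ∘ₗ P i)}

end


/-! For a theory whose channels commute with a finite family of symmetries of the state space that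
averages to `Λ`, the Holevo capacity is `χ(N) = sup_σ (s(𝟙 / n) - s(N(σ)))`: "≤" because the
maximally mixed state has the largest entropy and an average is at most a supremum, "≥" by
evaluating the Holevo quantity on the orbit of `σ`, whose average output is maximally mixed.
The right-hand side is monotone under `∑ p κ • E κ ∘ N ∘ P κ`: the `P κ` only shrink the set of
inputs, and the entropy is concave and does not decrease under the doubly stochastic `E κ`.
The symmetries are the Weyl conjugations in the covariant theory. For a qubit they are the identity
and the universal-NOT `X ↦ Tr(X) 𝟙 - X`, which commutes with every unital trace-preserving map. -/

open scoped ComplexOrder Matrix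

section ConvexSums

variable {ι : Type*} [Fintype ι] {w : ι → ℝ}

theorem sum_le_sum_mulVec_of_mem_doublyStochastic {𝕜 β : Type*} [Field 𝕜] [LinearOrder 𝕜]
    [IsStrictOrderedRing 𝕜] [AddCommGroup β] [PartialOrder β] [IsOrderedAddMonoid β] [Module 𝕜 β]
    [IsStrictOrderedModule 𝕜 β] [DecidableEq ι] {M : Matrix ι ι 𝕜} (hM : M ∈ doublyStochastic 𝕜 ι)
    {s : Set 𝕜} {f : 𝕜 → β} (hf : ConcaveOn 𝕜 s f) {x : ι → 𝕜} (hx : ∀ j, x j ∈ s) :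
    ∑ j, f (x j) ≤ ∑ i, f ((M *ᵥ x) i) :=
  calc ∑ j, f (x j) = ∑ j, (∑ i, M i j) • f (x j) := by
        simp only [sum_col_of_mem_doublyStochastic hM, one_smul]
    _ = ∑ i, ∑ j, M i j • f (x j) := by
        simp only [Finset.sum_smul]
        exact Finset.sum_comm
    _ ≤ ∑ i, f ((M *ᵥ x) i) := Finset.sum_le_sum fun i _ =>
        hf.le_map_sum (fun _ _ => nonneg_of_mem_doublyStochastic hM)
          (sum_row_of_mem_doublyStochastic hM i) fun j _ => hx j

lemma coe_sum_mul_le_iSup (hw : ∀ i, 0 ≤ w i) (hw1 : ∑ i, w i = 1) {α : Type*} (f : α → ℝ)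
    (x : ι → α) : ((∑ i, w i * f (x i) : ℝ) : EReal) ≤ ⨆ a, (f a : EReal) := by
  obtain ⟨i, -, hi⟩ := (convexOn_id convex_univ).exists_ge_of_centerMass
    (t := Finset.univ) (p := fun i => f (x i)) (fun i _ => hw i) (hw1 ▸ zero_lt_one)
    fun _ _ => Set.mem_univ _
  rw [Finset.centerMass_eq_of_sum_1 _ _ hw1] at hi
  exact (EReal.coe_le_coe hi).trans (le_iSup (fun a => (f a : EReal)) (x i))

lemma posSemidef_sum_ofReal_smul {m : Type*} (hw : ∀ i, 0 ≤ w i) {A : ι → Matrix m m ℂ}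
    (hA : ∀ i, (A i).PosSemidef) : (∑ i, (w i : ℂ) • A i).PosSemidef :=
  Matrix.posSemidef_sum _ fun i _ => (hA i).smul (by exact_mod_cast hw i)

lemma trace_sum_ofReal_smul {m : Type*} [Fintype m] (hw1 : ∑ i, w i = 1) {A : ι → Matrix m m ℂ}
    {c : ℂ} (hA : ∀ i, (A i).trace = c) : (∑ i, (w i : ℂ) • A i).trace = c := by
  simp only [Matrix.trace_sum, Matrix.trace_smul, hA]
  rw [← Finset.sum_smul, ← Complex.ofReal_sum, hw1, Complex.ofReal_one, one_smul]

end ConvexSums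

section PositiveMaps

/-- Positive trace-preserving maps: they send states to states, and all entropy estimates below
need no more than this much of complete positivity. -/
structure IsPositiveTracePreserving {n : ℕ} (N : QMap n) : Prop where
  map_posSemidef ⦃X : QOp n⦄ : X.PosSemidef → (N X).PosSemidef
  trace_map (X : QOp n) : (N X).trace = X.trace

/-- Doubly stochastic maps: positive, trace-preserving and unital. They are the quantum analogue
of doubly stochastic matrices. -/
structure IsDoublyStochasticMap {n : ℕ} (N : QMap n) : Prop
    extends IsPositiveTracePreserving N where
  map_one : N 1 = 1

variable {n : ℕ} {ι : Type*} [Fintype ι] {w : ι → ℝ} {E N : QMap n}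

lemma IsDensity.sum (hw : ∀ i, 0 ≤ w i) (hw1 : ∑ i, w i = 1) {ρ : ι → QOp n}
    (hρ : ∀ i, IsDensity (ρ i)) : IsDensity (∑ i, (w i : ℂ) • ρ i) where
  posSemidef := posSemidef_sum_ofReal_smul hw fun i => (hρ i).posSemidef
  trace_eq_one := trace_sum_ofReal_smul hw1 fun i => (hρ i).trace_eq_one

namespace IsPositiveTracePreserving

lemma isDensity_map (hN : IsPositiveTracePreserving N) {ρ : QOp n} (hρ : IsDensity ρ) :
    IsDensity (N ρ) where
  posSemidef := hN.map_posSemidef hρ.posSemidef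
  trace_eq_one := (hN.trace_map ρ).trans hρ.trace_eq_one

lemma comp (hE : IsPositiveTracePreserving E) (hN : IsPositiveTracePreserving N) :
    IsPositiveTracePreserving (E ∘ₗ N) where
  map_posSemidef _ hX := hE.map_posSemidef (hN.map_posSemidef hX)
  trace_map X := (hE.trace_map _).trans (hN.trace_map X)

lemma sum (hw : ∀ i, 0 ≤ w i) (hw1 : ∑ i, w i = 1) {T : ι → QMap n}
    (hT : ∀ i, IsPositiveTracePreserving (T i)) :
    IsPositiveTracePreserving (∑ i, (w i : ℂ) • T i) where
  map_posSemidef X hX := by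
    simpa only [LinearMap.sum_apply, LinearMap.smul_apply] using
      posSemidef_sum_ofReal_smul hw fun i => (hT i).map_posSemidef hX
  trace_map X := by
    simpa only [LinearMap.sum_apply, LinearMap.smul_apply] using
      trace_sum_ofReal_smul hw1 fun i => (hT i).trace_map X

end IsPositiveTracePreserving

namespace IsDoublyStochasticMap

lemma id : IsDoublyStochasticMap (LinearMap.id : QMap n) where
  map_posSemidef _ hX := hX
  trace_map _ := rfl
  map_one := rfl

lemma comp (hE : IsDoublyStochasticMap E) (hN : IsDoublyStochasticMap N) :
    IsDoublyStochasticMap (E ∘ₗ N) where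
  toIsPositiveTracePreserving := hE.toIsPositiveTracePreserving.comp hN.toIsPositiveTracePreserving
  map_one := by rw [LinearMap.comp_apply, hN.map_one, hE.map_one]

lemma sum (hw : ∀ i, 0 ≤ w i) (hw1 : ∑ i, w i = 1) {T : ι → QMap n}
    (hT : ∀ i, IsDoublyStochasticMap (T i)) : IsDoublyStochasticMap (∑ i, (w i : ℂ) • T i) where
  toIsPositiveTracePreserving := .sum hw hw1 fun i => (hT i).toIsPositiveTracePreserving
  map_one := by
    simp only [LinearMap.sum_apply, LinearMap.smul_apply, (hT _).map_one]
    rw [← Finset.sum_smul, ← Complex.ofReal_sum, hw1, Complex.ofReal_one, one_smul]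

end IsDoublyStochasticMap

/-- The matrix `(i, j) ↦ ⟨i|E(|j⟩⟨j|)|i⟩` of transition probabilities of a map between the
standard basis states. -/
noncomputable def transitionMatrix {n : ℕ} (E : QMap n) : Matrix (Fin n) (Fin n) ℝ :=
  Matrix.of fun i j => (E (Matrix.single j j 1) i i).re

lemma transitionMatrix_mulVec (E : QMap n) (v : Fin n → ℝ) (i : Fin n) :
    (transitionMatrix E *ᵥ v) i = (E (Matrix.diagonal fun j => (v j : ℂ)) i i).re := by
  have diagonal_eq : Matrix.diagonal (fun j => (v j : ℂ)) =
      ∑ j, (v j : ℂ) • Matrix.single j j (1 : ℂ) := by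
    simp [Matrix.smul_single, Matrix.sum_single_eq_diagonal]
  rw [diagonal_eq]
  simp only [Matrix.mulVec, dotProduct, transitionMatrix, Matrix.of_apply, map_sum, map_smul,
    Matrix.sum_apply, Matrix.smul_apply, Complex.re_sum, smul_eq_mul, Complex.re_ofReal_mul,
    mul_comm (v _)]

lemma IsDoublyStochasticMap.transitionMatrix_mem_doublyStochastic (hE : IsDoublyStochasticMap E) :
    transitionMatrix E ∈ doublyStochastic ℝ (Fin n) := by
  have single_posSemidef (j : Fin n) : (Matrix.single j j (1 : ℂ)).PosSemidef := by
    rw [← Matrix.diagonal_single]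
    exact .diagonal (Pi.single_nonneg.2 zero_le_one)
  refine mem_doublyStochastic_iff_sum.2 ⟨fun i j => ?_, fun i => ?_, fun j => ?_⟩
  · exact (Complex.nonneg_iff.1 (hE.map_posSemidef (single_posSemidef j)).diag_nonneg).1
  · calc ∑ j, transitionMatrix E i j = ((E (∑ j, Matrix.single j j 1)) i i).re := by
          simp [transitionMatrix, Matrix.sum_apply]
      _ = 1 := by
          rw [Matrix.sum_single_one, hE.map_one, Matrix.one_apply_eq, Complex.one_re]
  · calc ∑ i, transitionMatrix E i j = (E (Matrix.single j j 1)).trace.re := by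
          simp [transitionMatrix, Matrix.trace]
      _ = 1 := by rw [hE.trace_map, Matrix.trace_single_eq_same, Complex.one_re]

section UnitaryConj

/-- Conjugation `X ↦ U X U†` by a unitary matrix. -/
noncomputable def unitaryConj {n : ℕ} (U : Matrix.unitaryGroup (Fin n) ℂ) : QMap n :=
  LinearMap.mulLeftRight ℂ ((U : QOp n), star (U : QOp n))

variable (U : Matrix.unitaryGroup (Fin n) ℂ)

lemma unitaryConj_apply (X : QOp n) : unitaryConj U X = (U : QOp n) * X * (U : QOp n)ᴴ := rfl

lemma isDoublyStochasticMap_unitaryConj : IsDoublyStochasticMap (unitaryConj U) where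
  map_posSemidef X hX := hX.mul_mul_conjTranspose_same _
  trace_map X := by
    rw [unitaryConj_apply, Matrix.trace_mul_comm, ← mul_assoc, ← Matrix.star_eq_conjTranspose,
      Unitary.coe_star_mul_self, one_mul]
  map_one := by
    rw [unitaryConj_apply, mul_one]
    exact Unitary.coe_mul_star_self U

lemma unitaryConj_star_apply_unitaryConj (X : QOp n) :
    unitaryConj (star U) (unitaryConj U X) = X := by
  have hU : (U : QOp n)ᴴ * U = 1 := Unitary.coe_star_mul_self U
  simp only [unitaryConj_apply, Unitary.coe_star, Matrix.star_eq_conjTranspose,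
    Matrix.conjTranspose_conjTranspose]
  rw [← mul_assoc, ← mul_assoc, hU, one_mul, mul_assoc, hU, mul_one]

end UnitaryConj

lemma isDoublyStochasticMap_of_mem_mixedUnitaryChannels (hN : N ∈ mixedUnitaryChannels n) :
    IsDoublyStochasticMap N := by
  obtain ⟨k, p, U, hp, hp1, hU, hN⟩ := hN
  have N_eq : N = ∑ i, (p i : ℂ) • unitaryConj ⟨U i, hU i⟩ := by
    ext1 X
    simp only [hN, LinearMap.sum_apply, LinearMap.smul_apply, unitaryConj_apply]
  rw [N_eq]
  exact .sum hp hp1 fun i => isDoublyStochasticMap_unitaryConj _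

open scoped MatrixOrder Matrix.Norms.L2Operator CStarAlgebra in
lemma IsQuantumChannel.isPositiveTracePreserving (hN : IsQuantumChannel N) :
    IsPositiveTracePreserving N where
  map_posSemidef X hX := by
    obtain ⟨f, rfl⟩ := hN.completelyPositive
    exact Matrix.nonneg_iff_posSemidef.1 (map_nonneg f hX.nonneg)
  trace_map := hN.tracePreserving

end PositiveMaps

section FreeChannel

/-- The maximally mixed state `𝟙 / n`. -/
noncomputable def maximallyMixed (n : ℕ) : QOp n := (n : ℂ)⁻¹ • 1

variable {n : ℕ}

lemma freeChannel_apply (X : QOp n) : freeChannel n X = X.trace • maximallyMixed n := rfl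

lemma freeChannel_of_isDensity {ρ : QOp n} (hρ : IsDensity ρ) :
    freeChannel n ρ = maximallyMixed n := by
  rw [freeChannel_apply, hρ.trace_eq_one, one_smul]

lemma freeChannel_map {N : QMap n} (hN : IsPositiveTracePreserving N) (X : QOp n) :
    freeChannel n (N X) = freeChannel n X := by
  rw [freeChannel_apply, freeChannel_apply, hN.trace_map]

variable (n) [NeZero n]

lemma isDensity_maximallyMixed : IsDensity (maximallyMixed n) where
  posSemidef := Matrix.PosSemidef.one.smul (inv_nonneg.2 n.cast_nonneg)
  trace_eq_one := by simp [maximallyMixed, NeZero.ne]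

lemma isDoublyStochasticMap_freeChannel : IsDoublyStochasticMap (freeChannel n) where
  map_posSemidef _ hX := (isDensity_maximallyMixed n).posSemidef.smul hX.trace_nonneg
  trace_map X := by
    rw [freeChannel_apply, Matrix.trace_smul, (isDensity_maximallyMixed n).trace_eq_one,
      smul_eq_mul, mul_one]
  map_one := by simp [freeChannel_apply, maximallyMixed, NeZero.ne]

end FreeChannel

section Entropy

variable {n : ℕ} {ι : Type*} [Fintype ι] {w : ι → ℝ} {E : QMap n} {ρ : QOp n}

lemma vonNeumannEntropy_eq_sum (hρ : ρ.IsHermitian) :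
    vonNeumannEntropy ρ = ∑ i, Real.negMulLog (hρ.eigenvalues i) := dif_pos hρ

lemma unitaryConj_eigenvectorUnitary_diagonal (hρ : ρ.IsHermitian) :
    unitaryConj hρ.eigenvectorUnitary (Matrix.diagonal fun i => (hρ.eigenvalues i : ℂ)) = ρ :=
  hρ.spectral_theorem.symm

lemma re_unitaryConj_star_eigenvectorUnitary_apply (hρ : ρ.IsHermitian) (i : Fin n) :
    (unitaryConj (star hρ.eigenvectorUnitary) ρ i i).re = hρ.eigenvalues i := by
  conv_lhs => enter [1, 2]; rw [← unitaryConj_eigenvectorUnitary_diagonal hρ]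
  rw [unitaryConj_star_apply_unitaryConj, Matrix.diagonal_apply_eq, Complex.ofReal_re]

/-- Between the eigenbasis of the input and any orthonormal basis of the output, a doubly
stochastic map acts on probabilities as a doubly stochastic matrix. -/
theorem vonNeumannEntropy_le_sum_negMulLog_unitaryConj (hE : IsDoublyStochasticMap E)
    (hρ : ρ.PosSemidef) (V : Matrix.unitaryGroup (Fin n) ℂ) :
    vonNeumannEntropy ρ ≤ ∑ i, Real.negMulLog (unitaryConj V (E ρ) i i).re := by
  set U := hρ.isHermitian.eigenvectorUnitary
  have hM := ((isDoublyStochasticMap_unitaryConj V).comp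
    (hE.comp (isDoublyStochasticMap_unitaryConj U))).transitionMatrix_mem_doublyStochastic
  rw [vonNeumannEntropy_eq_sum hρ.isHermitian]
  refine (sum_le_sum_mulVec_of_mem_doublyStochastic hM Real.concaveOn_negMulLog
    hρ.eigenvalues_nonneg).trans_eq ?_
  simp only [transitionMatrix_mulVec, LinearMap.comp_apply, U,
    unitaryConj_eigenvectorUnitary_diagonal]

theorem vonNeumannEntropy_le_map (hE : IsDoublyStochasticMap E) (hρ : ρ.PosSemidef) :
    vonNeumannEntropy ρ ≤ vonNeumannEntropy (E ρ) := by
  have hEρ := (hE.map_posSemidef hρ).isHermitian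
  simpa only [vonNeumannEntropy_eq_sum hEρ, re_unitaryConj_star_eigenvectorUnitary_apply] using
    vonNeumannEntropy_le_sum_negMulLog_unitaryConj hE hρ (star hEρ.eigenvectorUnitary)

theorem sum_mul_vonNeumannEntropy_le (hw : ∀ k, 0 ≤ w k) (hw1 : ∑ k, w k = 1) {ρ : ι → QOp n}
    (hρ : ∀ k, (ρ k).PosSemidef) :
    ∑ k, w k * vonNeumannEntropy (ρ k) ≤ vonNeumannEntropy (∑ k, (w k : ℂ) • ρ k) := by
  have hmix := (posSemidef_sum_ofReal_smul hw hρ).isHermitian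
  set V := star hmix.eigenvectorUnitary
  have diag_nonneg (k : ι) (i : Fin n) : 0 ≤ (unitaryConj V (ρ k) i i).re :=
    (Complex.nonneg_iff.1
      ((isDoublyStochasticMap_unitaryConj V).map_posSemidef (hρ k)).diag_nonneg).1
  have diag_mix (i : Fin n) :
      ∑ k, w k * (unitaryConj V (ρ k) i i).re = hmix.eigenvalues i := by
    rw [← re_unitaryConj_star_eigenvectorUnitary_apply hmix]
    simp [V, Matrix.sum_apply]
  calc ∑ k, w k * vonNeumannEntropy (ρ k)
      ≤ ∑ k, w k * ∑ i, Real.negMulLog (unitaryConj V (ρ k) i i).re := by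
        gcongr with k
        · exact hw k
        · exact vonNeumannEntropy_le_sum_negMulLog_unitaryConj .id (hρ k) V
    _ = ∑ i, ∑ k, w k * Real.negMulLog (unitaryConj V (ρ k) i i).re := by
        simp only [Finset.mul_sum]
        exact Finset.sum_comm
    _ ≤ ∑ i, Real.negMulLog (∑ k, w k * (unitaryConj V (ρ k) i i).re) :=
        Finset.sum_le_sum fun i _ => Real.concaveOn_negMulLog.le_map_sum (fun k _ => hw k) hw1
          fun k _ => diag_nonneg k i
    _ = vonNeumannEntropy (∑ k, (w k : ℂ) • ρ k) := by
        simp only [diag_mix, vonNeumannEntropy_eq_sum hmix]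

/-- The negentropy `s(𝟙 / n) - s(ρ)`, the entropy defect with respect to the maximally mixed
state. -/
noncomputable def negentropy {n : ℕ} (ρ : QOp n) : ℝ :=
  vonNeumannEntropy (maximallyMixed n) - vonNeumannEntropy ρ

lemma negentropy_map_le (hE : IsDoublyStochasticMap E) (hρ : ρ.PosSemidef) :
    negentropy (E ρ) ≤ negentropy ρ :=
  sub_le_sub_left (vonNeumannEntropy_le_map hE hρ) _

lemma negentropy_sum_le (hw : ∀ k, 0 ≤ w k) (hw1 : ∑ k, w k = 1) {ρ : ι → QOp n}
    (hρ : ∀ k, (ρ k).PosSemidef) :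
    negentropy (∑ k, (w k : ℂ) • ρ k) ≤ ∑ k, w k * negentropy (ρ k) := by
  simp only [negentropy, mul_sub, Finset.sum_sub_distrib, ← Finset.sum_mul, hw1, one_mul]
  exact sub_le_sub_left (sum_mul_vonNeumannEntropy_le hw hw1 hρ) _

lemma negentropy_nonneg [NeZero n] (hρ : IsDensity ρ) : 0 ≤ negentropy ρ := by
  have h := vonNeumannEntropy_le_map (isDoublyStochasticMap_freeChannel n) hρ.posSemidef
  rw [freeChannel_of_isDensity hρ] at h
  exact sub_nonneg.2 h

end Entropy

section HolevoCapacity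

variable {n : ℕ} {ι : Type*} [Fintype ι] {w : ι → ℝ} {N : QMap n}

theorem holevoCapacity_eq_zero_of_forall_eq [NeZero n] {τ : QOp n}
    (hN : ∀ ρ, IsDensity ρ → N ρ = τ) : holevoCapacity N = 0 := by
  have : Nonempty (QEnsemble n) :=
    ⟨⟨1, fun _ => 1, fun _ => maximallyMixed n, fun _ => zero_le_one, by simp,
      fun _ => isDensity_maximallyMixed n⟩⟩
  have holevoQuantity_eq_zero (e : QEnsemble n) : holevoQuantity N e = 0 := by
    simp only [holevoQuantity, hN _ (e.state_isDensity _)]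
    rw [← Finset.sum_smul, ← Finset.sum_mul, ← Complex.ofReal_sum, e.prob_sum, Complex.ofReal_one,
      one_smul, one_mul, sub_self]
  simp only [holevoCapacity, holevoQuantity_eq_zero, EReal.coe_zero, ciSup_const]

theorem holevoCapacity_freeChannel (n : ℕ) [NeZero n] : holevoCapacity (freeChannel n) = 0 :=
  holevoCapacity_eq_zero_of_forall_eq fun _ => freeChannel_of_isDensity

lemma holevoQuantity_le_holevoCapacity (N : QMap n) (hw : ∀ k, 0 ≤ w k) (hw1 : ∑ k, w k = 1)
    {ρ : ι → QOp n} (hρ : ∀ k, IsDensity (ρ k)) :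
    ((vonNeumannEntropy (∑ k, (w k : ℂ) • N (ρ k)) -
      ∑ k, w k * vonNeumannEntropy (N (ρ k)) : ℝ) : EReal) ≤ holevoCapacity N := by
  let f := (Fintype.equivFin ι).symm
  let e : QEnsemble n := ⟨Fintype.card ι, w ∘ f, ρ ∘ f, fun _ => hw _,
    (f.sum_comp w).trans hw1, fun _ => hρ _⟩
  refine le_of_eq_of_le ?_ (le_iSup (fun e => (holevoQuantity N e : EReal)) e)
  rw [holevoQuantity, ← f.sum_comp, ← f.sum_comp]
  rfl

/-- The largest negentropy of an output state, as a supremum in the extended reals. -/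
noncomputable def maxOutputNegentropy {n : ℕ} (N : QMap n) : EReal :=
  ⨆ σ : {σ : QOp n // IsDensity σ}, (negentropy (N σ) : EReal)

theorem holevoCapacity_le_maxOutputNegentropy [NeZero n] (hN : IsPositiveTracePreserving N) :
    holevoCapacity N ≤ maxOutputNegentropy N := by
  refine iSup_le fun e => le_trans (EReal.coe_le_coe ?_) <|
    coe_sum_mul_le_iSup e.prob_nonneg e.prob_sum
      (fun σ : {σ : QOp n // IsDensity σ} => negentropy (N σ))
      fun i => ⟨e.state i, e.state_isDensity i⟩
  have average_nonneg : 0 ≤ negentropy (∑ i, (e.prob i : ℂ) • N (e.state i)) :=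
    negentropy_nonneg <| .sum e.prob_nonneg e.prob_sum fun i =>
      hN.isDensity_map (e.state_isDensity i)
  simp only [negentropy, mul_sub, Finset.sum_sub_distrib, ← Finset.sum_mul, e.prob_sum,
    one_mul] at average_nonneg ⊢
  rw [holevoQuantity]
  linarith

theorem maxOutputNegentropy_sum_comp_le (hN : IsPositiveTracePreserving N)
    (hw : ∀ k, 0 ≤ w k) (hw1 : ∑ k, w k = 1) {E P : ι → QMap n}
    (hE : ∀ k, IsDoublyStochasticMap (E k)) (hP : ∀ k, IsPositiveTracePreserving (P k)) :
    maxOutputNegentropy (∑ k, (w k : ℂ) • (E k ∘ₗ N ∘ₗ P k)) ≤ maxOutputNegentropy N := by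
  refine iSup_le fun σ => ?_
  have hPσ (k : ι) : IsDensity (P k σ) := (hP k).isDensity_map σ.2
  have hNPσ (k : ι) : (N (P k σ)).PosSemidef := (hN.isDensity_map (hPσ k)).posSemidef
  refine le_trans (EReal.coe_le_coe ?_) <| coe_sum_mul_le_iSup hw hw1
    (fun σ : {σ : QOp n // IsDensity σ} => negentropy (N σ)) fun k => ⟨P k σ, hPσ k⟩
  simp only [LinearMap.sum_apply, LinearMap.smul_apply, LinearMap.comp_apply]
  calc negentropy (∑ k, (w k : ℂ) • E k (N (P k σ)))
      ≤ ∑ k, w k * negentropy (E k (N (P k σ))) :=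
        negentropy_sum_le hw hw1 fun k => (hE k).map_posSemidef (hNPσ k)
    _ ≤ ∑ k, w k * negentropy (N (P k σ)) := by
        gcongr with k
        · exact hw k
        · exact negentropy_map_le (hE k) (hNPσ k)

/-- A finite family of symmetries of the state space (positive trace-preserving maps with a doubly
stochastic inverse) whose average with weights `w` is the free channel. Antiunitary symmetries are
allowed, so that the universal-NOT of a qubit qualifies. -/
structure IsDepolarizingTwirl {n : ℕ} {ι : Type*} [Fintype ι] (w : ι → ℝ) (T : ι → QMap n) :
    Prop where
  weight_nonneg (i : ι) : 0 ≤ w i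
  weight_sum : ∑ i, w i = 1
  isPositiveTracePreserving (i : ι) : IsPositiveTracePreserving (T i)
  exists_leftInverse (i : ι) : ∃ S, IsDoublyStochasticMap S ∧ ∀ X, S (T i X) = X
  sum_smul_eq : ∑ i, (w i : ℂ) • T i = freeChannel n

namespace IsDepolarizingTwirl

variable {T : ι → QMap n}

lemma sum_smul_apply (hT : IsDepolarizingTwirl w T) (X : QOp n) :
    ∑ i, (w i : ℂ) • T i X = freeChannel n X := by
  simp only [← hT.sum_smul_eq, LinearMap.sum_apply, LinearMap.smul_apply]

lemma vonNeumannEntropy_apply_le (hT : IsDepolarizingTwirl w T) (i : ι) {ρ : QOp n}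
    (hρ : ρ.PosSemidef) :
    vonNeumannEntropy (T i ρ) ≤ vonNeumannEntropy ρ := by
  obtain ⟨S, hS, hST⟩ := hT.exists_leftInverse i
  simpa only [hST] using
    vonNeumannEntropy_le_map hS ((hT.isPositiveTracePreserving i).map_posSemidef hρ)

lemma isDoublyStochasticMap_of_commute [NeZero n] (hT : IsDepolarizingTwirl w T)
    (hN : IsPositiveTracePreserving N) (hNT : ∀ i X, N (T i X) = T i (N X)) :
    IsDoublyStochasticMap N where
  toIsPositiveTracePreserving := hN
  map_one := by
    have hΛ := (isDoublyStochasticMap_freeChannel n).map_one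
    calc N 1 = N (freeChannel n 1) := by rw [hΛ]
      _ = freeChannel n (N 1) := by simp only [← hT.sum_smul_apply, map_sum, map_smul, hNT]
      _ = 1 := by rw [freeChannel_map hN, hΛ]

/-- The witness is the twirled ensemble `{w i, T i σ}`: its average output is maximally mixed. -/
theorem maxOutputNegentropy_le_holevoCapacity (hT : IsDepolarizingTwirl w T)
    (hN : IsPositiveTracePreserving N) (hNT : ∀ i X, N (T i X) = T i (N X)) :
    maxOutputNegentropy N ≤ holevoCapacity N := by
  refine iSup_le fun ⟨σ, hσ⟩ => le_trans (EReal.coe_le_coe ?_) <|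
    holevoQuantity_le_holevoCapacity N hT.weight_nonneg hT.weight_sum fun i =>
      (hT.isPositiveTracePreserving i).isDensity_map hσ
  have hNσ := hN.isDensity_map hσ
  simp only [hNT, hT.sum_smul_apply, freeChannel_of_isDensity hNσ, negentropy]
  refine sub_le_sub_left ?_ _
  calc ∑ i, w i * vonNeumannEntropy (T i (N σ)) ≤ ∑ i, w i * vonNeumannEntropy (N σ) := by
        gcongr with i
        · exact hT.weight_nonneg i
        · exact hT.vonNeumannEntropy_apply_le i hNσ.posSemidef
    _ = vonNeumannEntropy (N σ) := by rw [← Finset.sum_mul, hT.weight_sum, one_mul]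

end IsDepolarizingTwirl

end HolevoCapacity

section Qubit

/-- The universal-NOT `X ↦ Tr(X) 𝟙 - X` of a qubit, the antipodal map of the Bloch ball. -/
noncomputable def universalNot : QMap 2 := (2 : ℂ) • freeChannel 2 - LinearMap.id

lemma universalNot_apply (X : QOp 2) : universalNot X = (2 : ℂ) • freeChannel 2 X - X := rfl

lemma universalNot_eq_conj_transpose (X : QOp 2) :
    universalNot X = !![0, 1; -1, 0] * Xᵀ * (!![0, 1; -1, 0] : QOp 2)ᴴ := by
  ext i j
  fin_cases i <;> fin_cases j <;>
    simp [universalNot_apply, freeChannel_apply, maximallyMixed, Matrix.trace_fin_two,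
      Matrix.vecMul, dotProduct, Matrix.mul_apply, Fin.sum_univ_two] <;>
    ring

lemma isDoublyStochasticMap_universalNot : IsDoublyStochasticMap universalNot where
  map_posSemidef X hX := by
    rw [universalNot_eq_conj_transpose]
    exact hX.transpose.mul_mul_conjTranspose_same _
  trace_map X := by
    rw [universalNot_apply, Matrix.trace_sub, Matrix.trace_smul,
      (isDoublyStochasticMap_freeChannel 2).trace_map, smul_eq_mul]
    ring
  map_one := by
    rw [universalNot_apply, (isDoublyStochasticMap_freeChannel 2).map_one, two_smul,
      add_sub_cancel_right]

lemma universalNot_universalNot (X : QOp 2) : universalNot (universalNot X) = X := by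
  rw [universalNot_apply (universalNot X),
    freeChannel_map isDoublyStochasticMap_universalNot.toIsPositiveTracePreserving,
    universalNot_apply, sub_sub_cancel]

lemma isDepolarizingTwirl_universalNot :
    IsDepolarizingTwirl (fun _ => 1 / 2) ![LinearMap.id, universalNot] where
  weight_nonneg _ := by norm_num
  weight_sum := by simp
  isPositiveTracePreserving := Fin.forall_fin_two.2
    ⟨IsDoublyStochasticMap.id.toIsPositiveTracePreserving,
      isDoublyStochasticMap_universalNot.toIsPositiveTracePreserving⟩
  exists_leftInverse := Fin.forall_fin_two.2
    ⟨⟨LinearMap.id, .id, fun _ => rfl⟩,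
      ⟨universalNot, isDoublyStochasticMap_universalNot, universalNot_universalNot⟩⟩
  sum_smul_eq := by
    simp [universalNot, ← smul_add]

lemma IsDoublyStochasticMap.map_universalNot {N : QMap 2} (hN : IsDoublyStochasticMap N)
    (X : QOp 2) : N (universalNot X) = universalNot (N X) := by
  rw [universalNot_apply, universalNot_apply, freeChannel_map hN.toIsPositiveTracePreserving]
  simp [freeChannel_apply, maximallyMixed, hN.map_one]

lemma IsDoublyStochasticMap.map_universalNotTwirl {N : QMap 2} (hN : IsDoublyStochasticMap N) :
    ∀ i X, N (![LinearMap.id, universalNot] i X) = ![LinearMap.id, universalNot] i (N X) :=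
  Fin.forall_fin_two.2 ⟨fun _ => rfl, hN.map_universalNot⟩

end Qubit

section Weyl

lemma sum_pow_mul_inv_pow_of_isPrimitiveRoot {K : Type*} [Field K] {n : ℕ} {ω : K}
    (hω : IsPrimitiveRoot ω n) (c d : Fin n) :
    ∑ b : Fin n, ω ^ (b.val * c.val) * (ω ^ (b.val * d.val))⁻¹ = if c = d then (n : K) else 0 := by
  have hω0 : ω ≠ 0 := hω.ne_zero c.pos.ne'
  have summand_eq (b : Fin n) :
      ω ^ (b.val * c.val) * (ω ^ (b.val * d.val))⁻¹ = (ω ^ c.val / ω ^ d.val) ^ b.val := by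
    rw [div_pow, ← pow_mul, ← pow_mul, mul_comm c.val, mul_comm d.val, div_eq_mul_inv]
  simp only [summand_eq, Fin.sum_univ_eq_sum_range (fun b => (ω ^ c.val / ω ^ d.val) ^ b)]
  split_ifs with hcd
  · simp [hcd, hω0]
  · have ratio_ne_one : ω ^ c.val / ω ^ d.val ≠ 1 := fun h =>
      hcd <| Fin.ext <| hω.pow_inj c.isLt d.isLt <| (div_eq_one_iff_eq (pow_ne_zero _ hω0)).1 h
    have ratio_pow : (ω ^ c.val / ω ^ d.val) ^ n = 1 := by
      rw [div_pow, pow_right_comm, pow_right_comm ω d.val, hω.pow_eq_one, one_pow, one_pow, div_one]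
    rw [geom_sum_eq ratio_ne_one, ratio_pow, sub_self, zero_div]

variable {n : ℕ} [NeZero n]

lemma weylOperator_conj_apply (a b : Fin n) (X : QOp n) (r s : Fin n) :
    (weylOperator a b * X * (weylOperator a b)ᴴ) r s =
      Complex.exp (2 * Real.pi * Complex.I / n) ^ (b.val * (r - a).val) *
        (Complex.exp (2 * Real.pi * Complex.I / n) ^ (b.val * (s - a).val))⁻¹ *
          X (r - a) (s - a) := by
  have norm_exp : ‖Complex.exp (2 * Real.pi * Complex.I / n)‖ = 1 :=
    (Complex.isPrimitiveRoot_exp n (NeZero.ne n)).norm'_eq_one (NeZero.ne n)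
  have eq_add_iff (r c : Fin n) : r = c + a ↔ c = r - a := by rw [eq_sub_iff_add_eq, eq_comm]
  rw [RCLike.inv_eq_conj (by rw [norm_pow, norm_exp, one_pow])]
  simp only [Matrix.mul_apply, weylOperator, Matrix.of_apply, Matrix.conjTranspose_apply,
    eq_add_iff, apply_ite star, star_zero, ite_mul, zero_mul, mul_ite, mul_zero,
    Finset.sum_ite_eq', Finset.mem_univ, if_true, starRingEnd_apply]
  ring

lemma weylOperator_mem_unitaryGroup (a b : Fin n) :
    weylOperator a b ∈ Matrix.unitaryGroup (Fin n) ℂ := by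
  refine Matrix.mem_unitaryGroup_iff.2 (Matrix.ext fun r s => ?_)
  have conj_one := weylOperator_conj_apply a b 1 r s
  rw [mul_one] at conj_one
  rw [Matrix.star_eq_conjTranspose, conj_one]
  by_cases hrs : r = s <;> simp [hrs, Matrix.one_apply]

/-- The discrete Weyl operator, bundled as a unitary matrix. -/
noncomputable def weylUnitary (a b : Fin n) : Matrix.unitaryGroup (Fin n) ℂ :=
  ⟨weylOperator a b, weylOperator_mem_unitaryGroup a b⟩

lemma sum_weylOperator_conj (X : QOp n) :
    ∑ x : Fin n × Fin n, weylOperator x.1 x.2 * X * (weylOperator x.1 x.2)ᴴ =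
      ((n : ℂ) * X.trace) • (1 : QOp n) := by
  ext r s
  simp only [Matrix.sum_apply, Fintype.sum_prod_type, weylOperator_conj_apply, ← Finset.sum_mul,
    sum_pow_mul_inv_pow_of_isPrimitiveRoot (Complex.isPrimitiveRoot_exp n (NeZero.ne n)),
    sub_left_inj, Matrix.smul_apply, Matrix.one_apply, smul_eq_mul]
  split_ifs with hrs
  · rw [← hrs, ← Finset.mul_sum, mul_one, Matrix.trace]
    exact congrArg _ ((Equiv.subLeft r).sum_comp fun i => X i i)
  · simp only [zero_mul, Finset.sum_const_zero, mul_zero]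

lemma isDepolarizingTwirl_weyl :
    IsDepolarizingTwirl (fun _ => ((n : ℝ) * n)⁻¹)
      fun x : Fin n × Fin n => unitaryConj (weylUnitary x.1 x.2) where
  weight_nonneg _ := by positivity
  weight_sum := by
    have hn : (n : ℝ) ≠ 0 := NeZero.ne _
    simp only [Finset.sum_const, Finset.card_univ, Fintype.card_prod, Fintype.card_fin,
      nsmul_eq_mul, Nat.cast_mul]
    field_simp
  isPositiveTracePreserving _ := (isDoublyStochasticMap_unitaryConj _).toIsPositiveTracePreserving
  exists_leftInverse _ :=
    ⟨_, isDoublyStochasticMap_unitaryConj _, unitaryConj_star_apply_unitaryConj _⟩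
  sum_smul_eq := by
    have hn : (n : ℂ) ≠ 0 := NeZero.ne _
    ext1 X
    simp only [LinearMap.sum_apply, LinearMap.smul_apply, unitaryConj_apply, weylUnitary,
      ← Finset.smul_sum, sum_weylOperator_conj, freeChannel_apply, maximallyMixed, smul_smul]
    congr 1
    push_cast
    field_simp

lemma map_weylTwirl_of_mem_weylCovariantChannels {N : QMap n} (hN : N ∈ weylCovariantChannels n)
    (x : Fin n × Fin n) (X : QOp n) :
    N (unitaryConj (weylUnitary x.1 x.2) X) = unitaryConj (weylUnitary x.1 x.2) (N X) :=
  hN.2 x.1 x.2 X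

lemma isDoublyStochasticMap_of_mem_weylCovariantChannels {N : QMap n}
    (hN : N ∈ weylCovariantChannels n) : IsDoublyStochasticMap N :=
  isDepolarizingTwirl_weyl.isDoublyStochasticMap_of_commute hN.1.isPositiveTracePreserving
    (map_weylTwirl_of_mem_weylCovariantChannels hN)

end Weyl

theorem mainTheorem6_general {n : ℕ} [NeZero n] {ι : Type*} [Fintype ι] {w : ι → ℝ}
    {T : ι → QMap n} (hT : IsDepolarizingTwirl w T) {F : Set (QMap n)}
    (hF : ∀ E ∈ F, IsDoublyStochasticMap E) :
    holevoCapacity (freeChannel n) = 0 ∧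
      ∀ N, IsPositiveTracePreserving N → (∀ i X, N (T i X) = T i (N X)) →
        ∀ M, (∃ Pi ∈ allowedSuperchannels F, M = Pi N) → holevoCapacity M ≤ holevoCapacity N := by
  refine ⟨holevoCapacity_freeChannel n, ?_⟩
  rintro N hN hNT _ ⟨Pi, ⟨k, q, E, P, hq, hq1, hE, hP, hPi⟩, rfl⟩
  have hE' (l : Fin k) : IsDoublyStochasticMap (E l) := hF _ (hE l)
  have hP' (l : Fin k) : IsPositiveTracePreserving (P l) :=
    (hF _ (hP l)).toIsPositiveTracePreserving
  rw [hPi]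
  calc holevoCapacity (∑ l, (q l : ℂ) • (E l ∘ₗ N ∘ₗ P l))
      ≤ maxOutputNegentropy (∑ l, (q l : ℂ) • (E l ∘ₗ N ∘ₗ P l)) :=
        holevoCapacity_le_maxOutputNegentropy <| .sum hq hq1 fun l =>
          (hE' l).toIsPositiveTracePreserving.comp (hN.comp (hP' l))
    _ ≤ maxOutputNegentropy N := maxOutputNegentropy_sum_comp_le hN hq hq1 hE' hP'
    _ ≤ holevoCapacity N := hT.maxOutputNegentropy_le_holevoCapacity hN hNT

theorem mainTheorem6 :
    (holevoCapacity (freeChannel 2) = 0 ∧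
      ∀ N ∈ mixedUnitaryChannels 2, ∀ M ∈ mixedUnitaryChannels 2,
        (∃ Pi ∈ allowedSuperchannels (mixedUnitaryChannels 2), M = Pi N) →
          holevoCapacity M ≤ holevoCapacity N) ∧
    ∀ (n : ℕ) [NeZero n],
      holevoCapacity (freeChannel n) = 0 ∧
        ∀ N ∈ weylCovariantChannels n, ∀ M ∈ weylCovariantChannels n,
          (∃ Pi ∈ allowedSuperchannels (weylCovariantChannels n), M = Pi N) →
            holevoCapacity M ≤ holevoCapacity N := by
  have qubit := mainTheorem6_general isDepolarizingTwirl_universalNot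
    fun _ => isDoublyStochasticMap_of_mem_mixedUnitaryChannels
  refine ⟨⟨qubit.1, fun N hN M _ => ?_⟩, fun n _ => ?_⟩
  · have hN' := isDoublyStochasticMap_of_mem_mixedUnitaryChannels hN
    exact qubit.2 N hN'.toIsPositiveTracePreserving hN'.map_universalNotTwirl M
  · have weyl := mainTheorem6_general (n := n) isDepolarizingTwirl_weyl
      fun _ => isDoublyStochasticMap_of_mem_weylCovariantChannels
    exact ⟨weyl.1, fun N hN M _ => weyl.2 N hN.1.isPositiveTracePreserving
      (map_weylTwirl_of_mem_weylCovariantChannels hN) M⟩
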